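/- Let $f:\mathbb{R}^n\to\mathbb{R}$ and $g:\mathbb{R}^n\to\mathbb{R}^m$ be continuously differentiable, with $f$ strictly concave, every component $g_i$ convex, and the gradients $\nabla f,\nabla g_1,\dots,\nabla g_m$ locally Lipschitz. Assume Slater's condition: there is $x\in\mathbb{R}^n$ with $g_i(x)<0$ for all $i$. Let $L(x,\lambda)=f(x)-\lambda^\top g(x)$. A saddle point of $L$ is a point $(x_*,\lambda_*)\in\mathbb{R}^n\times\mathbb{R}^m_{\ge 0}$ with $L(x,\lambda_*)\le L(x_*,\lambda_*)\le L(x_*,\lambda)$ for all $x\in\mathbb{R}^n$ and $\lambda\in\mathbb{R}^m_{\ge 0}$. The primal-dual dynamics on $\mathbb{R}^n\times\mathbb{R}^m_{\ge 0}$ is $$\dot x=\nabla f(x)-\sum_{i=1}^m\lambda_i\nabla g_i(x),\qquad \dot\lambda_i=[g_i(x)]^+_{\lambda_i}\quad(i=1,\dots,m),$$ where $[a]^+_b=a$ if $b>0$ and $[a]^+_b=\max\{0,a\}$ if $b=0$. A (Carathéodory) solution on $[0,T)$, $0<T\le\infty$, is a curve $\gamma$ that is absolutely continuous on every compact subinterval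 of $[0,T)$ and, for almost every $t\in[0,T)$, lies in $\mathbb{R}^n\times\mathbb{R}^m_{\ge 0}$ and satisfies the equations at time $t$. **(Existence, uniqueness, invariance.)** For every $z_0\in\mathbb{R}^n\times\mathbb{R}^m_{\ge 0}$ there is a solution $\gamma$ of the primal-dual dynamics on $[0,\infty)$ with $\gamma(0)=z_0$. Every solution on an interval $[0,T)$, $0<T\le\infty$, that starts at $z_0$ coincides with $\gamma$ on $[0,T)$. Moreover, $\gamma(t)\in\mathbb{R}^n\times\mathbb{R}^m_{\ge 0}$ for all $t\ge 0$, and for every saddle point $(x_*,\lambda_*)$ of $L$, with $V(x,\lambda)=\tfrac12\left(\|x-x_*\|^2+\|\lambda-\lambda_*\|^2\right)$, one has $V(\gamma(t))\le V(z_0)$ for all $t\ge 0$. **(Continuity with respect to the initial condition.)** If $z_k\to z_0$ in $\mathbb{R}^n\times\mathbb{R}^m_{\ge 0}$, then the solutions $\gamma_k$ on $[0,\infty)$ with $\gamma_k(0)=z_k$ converge to the solution $\gamma$ on $[0,\infty)$ with $\gamma(0)=z_0$, uniformly on every compact subset of $[0,\infty)$. -/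

import Mathlib

namespace PrimalDual

/-- The space `ℝⁿ × ℝᵐ` of pairs `(x, λ)`. -/
abbrev State (n m : ℕ) : Type := EuclideanSpace ℝ (Fin n) × EuclideanSpace ℝ (Fin m)

/-- The set `ℝⁿ × ℝᵐ_{≥0}` on which the primal-dual dynamics live. -/
def domain (n m : ℕ) : Set (State n m) := {z | ∀ i, 0 ≤ z.2 i}

/-- The operator `[a]_b^+`, used for `b ≥ 0` only: it is `a` if `b > 0`, and `max {0, a}`
if `b = 0`. -/
noncomputable def posPart (a b : ℝ) : ℝ := if 0 < b then a else max 0 a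

/-- The Lagrangian `L(x, λ) = f(x) - λᵀ g(x)`. -/
noncomputable def lagrangian {n m : ℕ} (f : EuclideanSpace ℝ (Fin n) → ℝ)
    (g : EuclideanSpace ℝ (Fin n) → EuclideanSpace ℝ (Fin m)) (z : State n m) : ℝ :=
  f z.1 - ∑ i, z.2 i * g z.1 i

/-- `zs = (x⋆, λ⋆)` is a saddle point of the Lagrangian over `ℝⁿ × ℝᵐ_{≥0}`. -/
def IsSaddle {n m : ℕ} (f : EuclideanSpace ℝ (Fin n) → ℝ)
    (g : EuclideanSpace ℝ (Fin n) → EuclideanSpace ℝ (Fin m)) (zs : State n m) : Prop :=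
  zs ∈ domain n m ∧
    (∀ x : EuclideanSpace ℝ (Fin n), lagrangian f g (x, zs.2) ≤ lagrangian f g zs) ∧
    (∀ l : EuclideanSpace ℝ (Fin m), (∀ i, 0 ≤ l i) →
      lagrangian f g zs ≤ lagrangian f g (zs.1, l))

/-- Half the squared distance to `zs = (x⋆, λ⋆)`:
`V(x, λ) = (‖x - x⋆‖² + ‖λ - λ⋆‖²) / 2`, with Euclidean norms. -/
noncomputable def V {n m : ℕ} (zs z : State n m) : ℝ :=
  (1 / 2) * (‖z.1 - zs.1‖ ^ 2 + ‖z.2 - zs.2‖ ^ 2)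

/-- The right-hand side of the primal-dual dynamics,
`(∇f(x) - ∑ᵢ λᵢ ∇gᵢ(x), [g(x)]_λ^+)`; it is used on `domain n m` only. -/
noncomputable def field {n m : ℕ} (f : EuclideanSpace ℝ (Fin n) → ℝ)
    (g : EuclideanSpace ℝ (Fin n) → EuclideanSpace ℝ (Fin m)) (z : State n m) : State n m :=
  (gradient f z.1 - ∑ i, z.2 i • gradient (fun y => g y i) z.1,
    WithLp.toLp 2 (fun i => posPart (g z.1 i) (z.2 i)))

/-- Carathéodory solutions on `[0, T)`, `T ≤ ∞`, of `γ' = F(γ)` for a vector field `F` given on a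
set `D`: `γ` is absolutely continuous on every `[0, b]` with `0 ≤ b < T`, and for almost every
`t ∈ [0, T)` one has `γ(t) ∈ D` (so that `F(γ(t))` is meaningful) and `γ'(t) = F(γ(t))`. -/
def IsCaratheodorySolution {E : Type*} [NormedAddCommGroup E] [NormedSpace ℝ E]
    (D : Set E) (F : E → E) (T : EReal) (γ : ℝ → E) : Prop :=
  (∀ b : ℝ, 0 ≤ b → (b : EReal) < T → AbsolutelyContinuousOnInterval γ 0 b) ∧
    ∀ᵐ t : ℝ ∂MeasureTheory.volume, 0 ≤ t → (t : EReal) < T →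
      γ t ∈ D ∧ HasDerivAt γ (F (γ t)) t

end PrimalDual

/-!
Write `F` for the right-hand side of the dynamics. Concavity of `L` in `x`, its linearity in `λ`
and the complementarity built into `[·]⁺` give, in the Euclidean inner product,
`⟪z - w, F z⟫ ≤ L (x_z, λ_w) - L (x_w, λ_z)` for all `z = (x_z, λ_z)` and `w = (x_w, λ_w)` in the
domain. Adding the inequality with `z` and `w` exchanged shows that `F` is dissipative, so that the
distance between two solutions never increases: this is uniqueness and, uniformly in time,
continuity in the initial condition. Taking for `w` a saddle point shows that the distance to it
never increases.

For existence, `F` is discontinuous at the boundary, but it is the projection of the locally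
Lipschitz field `H = (∇ₓL, g)`. If `u' = H (R u)`, where `R` is Skorokhod reflection of the
multiplier coordinates at `0`, then `R u` is a Carathéodory solution: wherever a reflected
coordinate is positive the regulator is locally constant, and wherever it vanishes its path is at
a minimum. Since `R` is causal and Lipschitz in the supremum norm, Picard iteration solves this
equation for a Lipschitz `H`. A locally Lipschitz `H` is first cut off far away; dissipativity
bounds the speed at which solutions leave `z₀`, independently of the cutoff.
-/

namespace PrimalDual

open Set Filter Topology MeasureTheory
open scoped NNReal RealInnerProductSpace

section AbsolutelyContinuous

theorem absolutelyContinuousOnInterval_lipschitzWith_comp {X Y : Type*} [PseudoMetricSpace X]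
    [PseudoMetricSpace Y] {γ : ℝ → X} {φ : X → Y} {a b : ℝ} {K : ℝ≥0} (hφ : LipschitzWith K φ)
    (hγ : AbsolutelyContinuousOnInterval γ a b) :
    AbsolutelyContinuousOnInterval (fun t => φ (γ t)) a b := by
  refine squeeze_zero (fun E => Finset.sum_nonneg fun _ _ => dist_nonneg) (fun E => ?_)
    (by simpa using Tendsto.const_mul (K : ℝ) hγ)
  rw [Finset.mul_sum]
  exact Finset.sum_le_sum fun i _ => hφ.dist_le_mul _ _

theorem absolutelyContinuousOnInterval_congr {X : Type*} [PseudoMetricSpace X] {γ η : ℝ → X}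
    {a b : ℝ} (hγ : AbsolutelyContinuousOnInterval γ a b) (h : EqOn γ η (uIcc a b)) :
    AbsolutelyContinuousOnInterval η a b := by
  rw [absolutelyContinuousOnInterval_iff] at *
  intro ε hε
  obtain ⟨δ, hδ, hγδ⟩ := hγ ε hε
  refine ⟨δ, hδ, fun E hE hlt => ?_⟩
  convert hγδ E hE hlt using 1
  exact Finset.sum_congr rfl fun i hi => by rw [h (hE.1 i hi).1, h (hE.1 i hi).2]

theorem le_add_mul_of_ae_deriv_le {u : ℝ → ℝ} {a b C : ℝ} (hab : a ≤ b)
    (hu : AbsolutelyContinuousOnInterval u a b) (h : ∀ᵐ t : ℝ, t ∈ Ioo a b → deriv u t ≤ C) :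
    u b ≤ u a + C * (b - a) := by
  have hle : ∫ t in a..b, deriv u t ≤ ∫ _ in a..b, C := by
    refine intervalIntegral.integral_mono_ae_restrict hab hu.intervalIntegrable_deriv
      intervalIntegrable_const ?_
    rw [← Measure.restrict_congr_set Ioo_ae_eq_Icc]
    exact (ae_restrict_iff' measurableSet_Ioo).2 h
  rw [hu.integral_deriv_eq_sub, intervalIntegral.integral_const, smul_eq_mul] at hle
  linarith

variable {H : Type*} [NormedAddCommGroup H] [InnerProductSpace ℝ H]

theorem deriv_norm_le_of_inner_le {γ : ℝ → H} {γ' : H} {t C : ℝ} (hC : 0 ≤ C)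
    (hγ : HasDerivAt γ γ' t) (hd : DifferentiableAt ℝ (fun s => ‖γ s‖) t)
    (hle : ⟪γ t, γ'⟫ ≤ C * ‖γ t‖) : deriv (fun s => ‖γ s‖) t ≤ C := by
  rcases (norm_nonneg (γ t)).eq_or_lt with h0 | hpos
  · have hmin : IsLocalMin (fun s => ‖γ s‖) t :=
      Eventually.of_forall fun s => h0.ge.trans (norm_nonneg (γ s))
    exact hmin.deriv_eq_zero.trans_le hC
  · have hsq : 2 * ‖γ t‖ * deriv (fun s => ‖γ s‖) t = 2 * ⟪γ t, γ'⟫ := by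
      simpa using (hd.hasDerivAt.pow 2).unique hγ.norm_sq
    nlinarith

theorem norm_le_norm_add_mul_of_ae_inner_le {γ : ℝ → H} {a b C : ℝ} (hC : 0 ≤ C) (hab : a ≤ b)
    (hγ : AbsolutelyContinuousOnInterval γ a b)
    (h : ∀ᵐ t : ℝ, t ∈ Ioo a b → ∃ γ', HasDerivAt γ γ' t ∧ ⟪γ t, γ'⟫ ≤ C * ‖γ t‖) :
    ‖γ b‖ ≤ ‖γ a‖ + C * (b - a) := by
  have hν := absolutelyContinuousOnInterval_lipschitzWith_comp lipschitzWith_one_norm hγ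
  refine le_add_mul_of_ae_deriv_le hab hν ?_
  filter_upwards [h, hν.ae_differentiableAt] with t ht hd hmem
  obtain ⟨γ', hγ', hle⟩ := ht hmem
  exact deriv_norm_le_of_inner_le hC hγ' (hd (uIcc_of_le hab ▸ Ioo_subset_Icc_self hmem)) hle

end AbsolutelyContinuous

section Caratheodory

variable {E : Type*} [NormedAddCommGroup E] [NormedSpace ℝ E]
  {H : Type*} [NormedAddCommGroup H] [InnerProductSpace ℝ H]
  {D D' : Set E} {F F' : E → E} {S T : EReal} {γ η : ℝ → E} {t C : ℝ}

theorem isCaratheodorySolution_const (p : E) :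
    IsCaratheodorySolution {p} (fun _ => 0) ⊤ fun _ => p :=
  ⟨fun _ _ _ => (LipschitzWith.const p).lipschitzOnWith.absolutelyContinuousOnInterval,
    Eventually.of_forall fun t _ _ => ⟨rfl, hasDerivAt_const t p⟩⟩

theorem IsCaratheodorySolution.mono (hγ : IsCaratheodorySolution D F T γ) (hST : S ≤ T) :
    IsCaratheodorySolution D F S γ :=
  ⟨fun b hb hbS => hγ.1 b hb (hbS.trans_le hST),
    hγ.2.mono fun _ ht h0 htS => ht h0 (htS.trans_le hST)⟩

theorem IsCaratheodorySolution.mem_of_isClosed (hγ : IsCaratheodorySolution D F T γ)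
    (hD : IsClosed D) (ht : 0 ≤ t) (htT : (t : EReal) < T) : γ t ∈ D := by
  obtain ⟨b, htb, hbT⟩ := EReal.lt_iff_exists_real_btwn.1 htT
  rw [EReal.coe_lt_coe_iff] at htb
  have hγc : ContinuousOn γ (Icc 0 b) :=
    uIcc_of_le (ht.trans htb.le) ▸ (hγ.1 b (ht.trans htb.le) hbT).continuousOn
  have hdense := (Measure.dense_of_ae hγ.2).open_subset_closure_inter (isOpen_Ioo (a := t) (b := b))
  have htcl := closure_mono hdense (closure_Ioo htb.ne ▸ left_mem_Icc.2 htb.le)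
  rw [closure_closure] at htcl
  rw [← hD.closure_eq]
  refine ((hγc t ⟨ht, htb.le⟩).mono fun s hs => ?_).mem_closure htcl fun s hs => ?_
  · exact ⟨ht.trans hs.1.1.le, hs.1.2.le⟩
  · exact (hs.2 (ht.trans hs.1.1.le) ((EReal.coe_lt_coe_iff.2 hs.1.2).trans hbT)).1

theorem IsCaratheodorySolution.norm_map_sub_le (A : E →L[ℝ] H) (hC : 0 ≤ C)
    (hγ : IsCaratheodorySolution D F T γ) (hη : IsCaratheodorySolution D' F' T η)
    (h : ∀ z ∈ D, ∀ w ∈ D', ⟪A (z - w), A (F z - F' w)⟫ ≤ C * ‖A (z - w)‖)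
    (ht : 0 ≤ t) (htT : (t : EReal) < T) :
    ‖A (γ t - η t)‖ ≤ ‖A (γ 0 - η 0)‖ + C * t := by
  have hac := absolutelyContinuousOnInterval_lipschitzWith_comp A.lipschitz
    ((hγ.1 t ht htT).sub (hη.1 t ht htT))
  have hle := norm_le_norm_add_mul_of_ae_inner_le hC ht hac ?_
  · simpa using hle
  filter_upwards [hγ.2, hη.2] with s hsγ hsη hs
  have hsT := (EReal.coe_lt_coe_iff.2 hs.2).trans htT
  obtain ⟨hzD, hz⟩ := hsγ hs.1.le hsT
  obtain ⟨hwD, hw⟩ := hsη hs.1.le hsT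
  exact ⟨_, A.hasFDerivAt.comp_hasDerivAt s (hz.sub hw), h _ hzD _ hwD⟩

theorem exists_isCaratheodorySolution_top {z₀ : E}
    (huniq : ∀ (b : ℝ) (γ η : ℝ → E), IsCaratheodorySolution D F b γ →
      IsCaratheodorySolution D F b η → γ 0 = η 0 → EqOn γ η (Ico 0 b))
    (hex : ∀ b : ℝ, ∃ γ, IsCaratheodorySolution D F b γ ∧ γ 0 = z₀) :
    ∃ γ, IsCaratheodorySolution D F ⊤ γ ∧ γ 0 = z₀ := by
  choose γ hγ hγ0 using fun N : ℕ => hex (N + 1 : ℕ)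
  have hlt : ∀ t : ℝ, t < (⌊t⌋₊ + 1 : ℕ) := fun t => by exact_mod_cast Nat.lt_floor_add_one t
  have hglue : ∀ (N : ℕ), EqOn (fun t => γ ⌊t⌋₊ t) (γ N) (Ico 0 (N + 1 : ℕ)) := by
    intro N t ht
    have hle : (⌊t⌋₊ + 1 : ℕ) ≤ N + 1 :=
      Nat.succ_le_of_lt ((Nat.floor_lt ht.1).2 ht.2)
    refine huniq _ _ _ (hγ _) ((hγ N).mono ?_) ((hγ0 _).trans (hγ0 N).symm) ⟨ht.1, hlt t⟩
    exact_mod_cast hle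
  refine ⟨fun t => γ ⌊t⌋₊ t, ⟨fun b hb _ => ?_, ?_⟩, by simp [hγ0]⟩
  · refine absolutelyContinuousOnInterval_congr
      ((hγ ⌊b⌋₊).1 b hb (EReal.coe_lt_coe_iff.2 (hlt b))) fun t ht => ?_
    rw [uIcc_of_le hb] at ht
    exact (hglue _ ⟨ht.1, ht.2.trans_lt (hlt b)⟩).symm
  · filter_upwards [ae_all_iff.2 fun N => (hγ N).2, Measure.ae_ne volume 0] with t ht hne h0t _
    obtain ⟨hD, hderiv⟩ := ht ⌊t⌋₊ h0t (EReal.coe_lt_coe_iff.2 (hlt t))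
    refine ⟨hD, hderiv.congr_of_eventuallyEq ?_⟩
    filter_upwards [Ioo_mem_nhds (h0t.lt_of_ne' hne) (hlt t)] with s hs
    exact hglue _ ⟨hs.1.le, hs.2⟩

/-- Dissipativity on `D` of the field `F` for the semi-inner product `⟪A ·, A ·⟫`. The map `A` into
an inner product space supplies the geometry when the norm of `E` is not Euclidean. -/
def IsDissipativeOn (A : E →L[ℝ] H) (D : Set E) (F : E → E) : Prop :=
  ∀ ⦃z⦄, z ∈ D → ∀ ⦃w⦄, w ∈ D → ⟪A (z - w), A (F z - F w)⟫ ≤ 0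

variable {A : E →L[ℝ] H}

theorem IsDissipativeOn.norm_map_sub_le (hF : IsDissipativeOn A D F)
    (hγ : IsCaratheodorySolution D F T γ) (hη : IsCaratheodorySolution D F T η)
    (ht : 0 ≤ t) (htT : (t : EReal) < T) : ‖A (γ t - η t)‖ ≤ ‖A (γ 0 - η 0)‖ := by
  simpa using hγ.norm_map_sub_le A le_rfl hη (fun z hz w hw => by simpa using hF hz hw) ht htT

theorem IsDissipativeOn.eq_of_isCaratheodorySolution (hF : IsDissipativeOn A D F)
    (hA : Function.Injective A) (hγ : IsCaratheodorySolution D F T γ)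
    (hη : IsCaratheodorySolution D F T η) (h0 : γ 0 = η 0) (ht : 0 ≤ t)
    (htT : (t : EReal) < T) : γ t = η t := by
  have hle := hF.norm_map_sub_le hγ hη ht htT
  rw [h0, sub_self, map_zero, norm_zero, norm_le_zero_iff, map_sub, sub_eq_zero] at hle
  exact hA hle

theorem IsDissipativeOn.norm_map_sub_initial_le_of_smul {θ : E → ℝ} (hF : IsDissipativeOn A D F)
    (hθ : ∀ z, θ z ∈ Icc 0 1) (hγ : IsCaratheodorySolution D (fun z => θ z • F z) T γ)
    (h0 : γ 0 ∈ D) (ht : 0 ≤ t) (htT : (t : EReal) < T) :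
    ‖A (γ t - γ 0)‖ ≤ ‖A (F (γ 0))‖ * t := by
  have hle := hγ.norm_map_sub_le A (norm_nonneg (A (F (γ 0))))
    ((isCaratheodorySolution_const (γ 0)).mono le_top) ?_ ht htT
  · simpa using hle
  rintro z hz _ rfl
  have hdiss := hF hz h0
  have hcs := real_inner_le_norm (A (z - γ 0)) (A (F (γ 0)))
  rw [map_sub A (F z), inner_sub_right] at hdiss
  calc ⟪A (z - γ 0), A (θ z • F z - 0)⟫ = θ z * ⟪A (z - γ 0), A (F z)⟫ := by
        rw [sub_zero, map_smul, real_inner_smul_right]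
    _ ≤ θ z * (‖A (F (γ 0))‖ * ‖A (z - γ 0)‖) :=
        mul_le_mul_of_nonneg_left (by linarith) (hθ z).1
    _ ≤ ‖A (F (γ 0))‖ * ‖A (z - γ 0)‖ := mul_le_of_le_one_left (by positivity) (hθ z).2

theorem IsDissipativeOn.tendstoUniformlyOn {ι : Type*} {l : Filter ι} {K : ℝ≥0} {γs : ι → ℝ → E}
    (hF : IsDissipativeOn A D F) (hA : AntilipschitzWith K A)
    (hγs : ∀ k, IsCaratheodorySolution D F ⊤ (γs k)) (hγ : IsCaratheodorySolution D F ⊤ γ)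
    (h0 : Tendsto (fun k => γs k 0) l (𝓝 (γ 0))) : TendstoUniformlyOn γs γ l (Ici 0) := by
  have hinit : Tendsto (fun k => K * ‖A (γ 0 - γs k 0)‖) l (𝓝 0) := by
    have hcont : Continuous fun z => K * ‖A (γ 0 - z)‖ := by fun_prop
    simpa only [sub_self, map_zero, norm_zero, mul_zero, Function.comp_def]
      using (hcont.tendsto (γ 0)).comp h0
  rw [Metric.tendstoUniformlyOn_iff]
  intro ε hε
  filter_upwards [hinit.eventually_lt_const hε] with k hk t ht
  calc dist (γ t) (γs k t) ≤ K * dist (A (γ t)) (A (γs k t)) := hA.le_mul_dist _ _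
    _ = K * ‖A (γ t - γs k t)‖ := by rw [dist_eq_norm, map_sub]
    _ ≤ K * ‖A (γ 0 - γs k 0)‖ := by
      gcongr
      exact hF.norm_map_sub_le hγ (hγs k) ht (EReal.coe_lt_top t)
    _ < ε := hk

end Caratheodory

section Causal

variable {E F G : Type*} [PseudoMetricSpace E] [PseudoMetricSpace F] [PseudoMetricSpace G]
  {K L : ℝ≥0}

/-- A functional `Φ` on paths is causally `K`-Lipschitz if, for every `t ≥ 0`, the value `Φ u t`
depends only on the restriction of `u` to `[0, t]`, in a `K`-Lipschitz way for the supremum norm. -/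
def IsCausalLipschitz (K : ℝ≥0) (Φ : C(ℝ, E) → C(ℝ, F)) : Prop :=
  ∀ ⦃u v : C(ℝ, E)⦄ ⦃t c : ℝ⦄, 0 ≤ t → (∀ s ∈ Icc 0 t, dist (u s) (v s) ≤ c) →
    dist (Φ u t) (Φ v t) ≤ K * c

theorem isCausalLipschitz_comp {φ : F → G} (hφ : LipschitzWith L φ) {Φ : C(ℝ, E) → C(ℝ, F)}
    (hΦ : IsCausalLipschitz K Φ) :
    IsCausalLipschitz (L * K) fun u => ContinuousMap.comp ⟨φ, hφ.continuous⟩ (Φ u) := by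
  intro u v t c ht h
  calc dist (φ (Φ u t)) (φ (Φ v t)) ≤ L * dist (Φ u t) (Φ v t) := hφ.dist_le_mul _ _
    _ ≤ L * (K * c) := by gcongr; exact hΦ ht h
    _ = (L * K : ℝ≥0) * c := by push_cast; ring

end Causal

section RunningSup

/-- The running supremum `t ↦ sup_{0 ≤ s ≤ t} w s`. Parametrizing `[0, t]` by the unit interval
makes its continuity a compactness statement; only the values at `t ≥ 0` matter. -/
noncomputable def runningSup (w : C(ℝ, ℝ)) : C(ℝ, ℝ) where
  toFun t := sSup ((fun θ => w (θ * t)) '' Icc 0 1)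
  continuous_toFun := isCompact_Icc.continuous_sSup (f := fun t θ => w (θ * t)) (by fun_prop)

variable {w w' : C(ℝ, ℝ)} {s t c : ℝ}

theorem le_runningSup (hs : s ∈ Icc 0 t) : w s ≤ runningSup w t := by
  refine le_csSup (isCompact_Icc.bddAbove_image (by fun_prop)) ?_
  rcases hs.1.eq_or_lt with rfl | hs0
  · exact ⟨0, by simp, by simp⟩
  · have ht : 0 < t := hs0.trans_le hs.2
    exact ⟨s / t, ⟨by positivity, (div_le_one ht).2 hs.2⟩, by simp [ht.ne']⟩

theorem runningSup_le (ht : 0 ≤ t) (h : ∀ s ∈ Icc 0 t, w s ≤ c) : runningSup w t ≤ c := by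
  refine csSup_le ((nonempty_Icc.2 zero_le_one).image _) ?_
  rintro _ ⟨θ, hθ, rfl⟩
  exact h _ ⟨mul_nonneg hθ.1 ht, mul_le_of_le_one_left ht hθ.2⟩

theorem monotoneOn_runningSup (w : C(ℝ, ℝ)) : MonotoneOn (runningSup w) (Ici 0) :=
  fun _ hs _ _ hst => runningSup_le hs fun _ hr => le_runningSup ⟨hr.1, hr.2.trans hst⟩

theorem isCausalLipschitz_runningSup : IsCausalLipschitz 1 runningSup := by
  intro u v t c ht h
  have hle : ∀ {u v : C(ℝ, ℝ)}, (∀ s ∈ Icc 0 t, dist (u s) (v s) ≤ c) →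
      runningSup u t - runningSup v t ≤ c := fun {u v} h =>
    sub_le_iff_le_add.2 <| runningSup_le ht fun s hs => by
      linarith [(abs_le.1 (h s hs)).2, le_runningSup (w := v) hs]
  rw [NNReal.coe_one, one_mul, Real.dist_eq]
  exact abs_sub_le_iff.2 ⟨hle h, hle fun s hs => dist_comm (u s) (v s) ▸ h s hs⟩

theorem lipschitzOnWith_runningSup {K : ℝ≥0} {b : ℝ} (h : LipschitzOnWith K w (Icc 0 b)) :
    LipschitzOnWith K (runningSup w) (Icc 0 b) := by
  refine LipschitzOnWith.of_le_add_mul K fun t ht s hs => ?_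
  have hpos : 0 ≤ K * dist t s := by positivity
  refine runningSup_le ht.1 fun r hr => ?_
  rcases le_total r s with hrs | hsr
  · exact (le_runningSup ⟨hr.1, hrs⟩).trans (le_add_of_nonneg_right hpos)
  · have hdist : dist r s ≤ dist t s := by
      rw [Real.dist_eq, Real.dist_eq, abs_of_nonneg (sub_nonneg.2 hsr),
        abs_of_nonneg (sub_nonneg.2 (hsr.trans hr.2))]
      linarith [hr.2]
    calc w r ≤ w s + K * dist r s := h.le_add_mul ⟨hr.1, hr.2.trans ht.2⟩ hs
      _ ≤ runningSup w s + K * dist t s := by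
        gcongr
        exact le_runningSup ⟨hs.1, le_rfl⟩

theorem runningSup_eq_of_forall_le (hs : 0 ≤ s) (hst : s ≤ t)
    (h : ∀ r ∈ Icc s t, w r ≤ runningSup w s) : runningSup w t = runningSup w s := by
  refine le_antisymm (runningSup_le (hs.trans hst) fun r hr => ?_)
    (monotoneOn_runningSup w hs (hs.trans hst) hst)
  rcases le_total r s with hrs | hsr
  · exact le_runningSup ⟨hr.1, hrs⟩
  · exact h r ⟨hsr, hr.2⟩

theorem runningSup_eventuallyEq_of_lt (ht : 0 < t) (h : w t < runningSup w t) :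
    ∀ᶠ s in 𝓝 t, runningSup w s = runningSup w t := by
  obtain ⟨c, hwc, hcM⟩ := exists_between h
  have hev : ∀ᶠ s in 𝓝 t, w s < c ∧ c < runningSup w s ∧ 0 < s :=
    (w.continuous.continuousAt.eventually_lt_const hwc).and
      (((runningSup w).continuous.continuousAt.eventually_const_lt hcM).and (lt_mem_nhds ht))
  obtain ⟨ε, hε, hball⟩ := Metric.eventually_nhds_iff_ball.1 hev
  have hconst : ∀ s ∈ Metric.ball t ε, ∀ s' ∈ Metric.ball t ε, s ≤ s' →
      runningSup w s' = runningSup w s := fun s hs s' hs' hle =>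
    runningSup_eq_of_forall_le (hball s hs).2.2.le hle fun r hr =>
      ((hball r ((convex_ball t ε).ordConnected.out hs hs' hr)).1.trans (hball s hs).2.1).le
  filter_upwards [Metric.ball_mem_nhds t hε] with s hs
  rcases le_total s t with hst | hts
  · exact (hconst s hs t (Metric.mem_ball_self hε) hst).symm
  · exact hconst t (Metric.mem_ball_self hε) s hs hts

end RunningSup

section Reflection

/-- The regulator of the Skorokhod problem for `y`: the least nondecreasing nonnegative path whose
sum with `y` is nonnegative. -/
noncomputable def regulator (y : C(ℝ, ℝ)) : C(ℝ, ℝ) where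
  toFun t := max 0 (runningSup (-y) t)
  continuous_toFun := by fun_prop

/-- The Skorokhod reflection at `0` of a real path. -/
noncomputable def reflection (y : C(ℝ, ℝ)) : C(ℝ, ℝ) := y + regulator y

variable {y : C(ℝ, ℝ)} {t a : ℝ}

theorem reflection_nonneg (ht : 0 ≤ t) : 0 ≤ reflection y t := by
  have hle : -y t ≤ regulator y t :=
    (le_runningSup (w := -y) ⟨ht, le_rfl⟩).trans (le_max_right _ _)
  rw [reflection, ContinuousMap.add_apply]
  linarith

theorem reflection_zero (h0 : 0 ≤ y 0) : reflection y 0 = y 0 := by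
  have hle : runningSup (-y) 0 ≤ 0 := runningSup_le le_rfl fun s hs => by
    rw [Icc_self, mem_singleton_iff] at hs
    simpa [hs] using h0
  simp [reflection, regulator, hle]

theorem monotoneOn_regulator (y : C(ℝ, ℝ)) : MonotoneOn (regulator y) (Ici 0) :=
  fun _ hs _ ht hst => max_le_max le_rfl (monotoneOn_runningSup (-y) hs ht hst)

theorem isCausalLipschitz_regulator : IsCausalLipschitz 1 regulator := by
  intro u v t c ht h
  have hsup := isCausalLipschitz_runningSup (u := -u) (v := -v) ht (by simpa using h)
  have hmax := (LipschitzWith.id.const_max 0).dist_le_mul (runningSup (-u) t) (runningSup (-v) t)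
  rw [NNReal.coe_one, one_mul] at hmax
  exact hmax.trans hsup

theorem isCausalLipschitz_reflection : IsCausalLipschitz 2 reflection := by
  intro u v t c ht h
  calc dist (u t + regulator u t) (v t + regulator v t)
      ≤ dist (u t) (v t) + dist (regulator u t) (regulator v t) := dist_add_add_le _ _ _ _
    _ ≤ c + (1 : ℝ≥0) * c := add_le_add (h t ⟨ht, le_rfl⟩) (isCausalLipschitz_regulator ht h)
    _ = (2 : ℝ≥0) * c := by push_cast; ring

theorem lipschitzOnWith_reflection {K : ℝ≥0} {b : ℝ} (h : LipschitzOnWith K y (Icc 0 b)) :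
    LipschitzOnWith (2 * K) (reflection y) (Icc 0 b) := by
  have hreg : LipschitzOnWith (1 * K) (regulator y) (Icc 0 b) :=
    (LipschitzWith.id.const_max 0).comp_lipschitzOnWith (lipschitzOnWith_runningSup h.neg)
  rw [two_mul]
  exact h.add (one_mul K ▸ hreg)

theorem regulator_eventuallyEq_of_pos (ht : 0 < t) (hpos : 0 < reflection y t) :
    ∀ᶠ s in 𝓝 t, regulator y s = regulator y t := by
  rcases lt_or_ge (runningSup (-y) t) 0 with hneg | hnonneg
  · filter_upwards [(runningSup (-y)).continuous.continuousAt.eventually_lt_const hneg] with s hs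
    exact (max_eq_left hs.le).trans (max_eq_left hneg.le).symm
  · have hlt : (-y) t < runningSup (-y) t := by
      have hreg : regulator y t = runningSup (-y) t := max_eq_right hnonneg
      rw [reflection, ContinuousMap.add_apply, hreg] at hpos
      simpa using neg_lt_iff_pos_add'.2 hpos
    filter_upwards [runningSup_eventuallyEq_of_lt ht hlt] with s hs
    exact congrArg (max 0) hs

theorem hasDerivAt_reflection_of_pos (ht : 0 < t) (hy : HasDerivAt y a t)
    (hpos : 0 < reflection y t) : HasDerivAt (reflection y) a t := by
  refine (hy.add_const (regulator y t)).congr_of_eventuallyEq ?_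
  filter_upwards [regulator_eventuallyEq_of_pos ht hpos] with s hs
  exact congrArg (y s + ·) hs

theorem hasDerivAt_reflection_of_eq_zero (ht : 0 < t)
    (hd : DifferentiableAt ℝ (reflection y) t) (h0 : reflection y t = 0) :
    HasDerivAt (reflection y) 0 t := by
  have hmin : IsLocalMin (reflection y) t := by
    filter_upwards [lt_mem_nhds ht] with s hs
    exact h0.trans_le (reflection_nonneg hs.le)
  exact hmin.deriv_eq_zero ▸ hd.hasDerivAt

theorem nonpos_of_hasDerivAt_of_reflection_eq_zero (ht : 0 < t) (hy : HasDerivAt y a t)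
    (hd : DifferentiableAt ℝ (reflection y) t) (h0 : reflection y t = 0) : a ≤ 0 := by
  have hreg : HasDerivAt (regulator y) (0 - a) t := by
    refine ((hasDerivAt_reflection_of_eq_zero ht hd h0).sub hy).congr_of_eventuallyEq
      (Eventually.of_forall fun s => ?_)
    simp [reflection]
  have hnonneg : 0 ≤ derivWithin (regulator y) (Ioi 0) t :=
    ((monotoneOn_regulator y).mono Ioi_subset_Ici_self).derivWithin_nonneg
  rw [derivWithin_of_isOpen isOpen_Ioi ht, hreg.deriv] at hnonneg
  linarith

theorem hasDerivAt_reflection (ht : 0 < t) (hy : HasDerivAt y a t)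
    (hd : DifferentiableAt ℝ (reflection y) t) :
    HasDerivAt (reflection y) (posPart a (reflection y t)) t := by
  rw [posPart]
  split_ifs with hpos
  · exact hasDerivAt_reflection_of_pos ht hy hpos
  · have h0 := le_antisymm (not_lt.1 hpos) (reflection_nonneg ht.le)
    rw [max_eq_left (nonpos_of_hasDerivAt_of_reflection_eq_zero ht hy hd h0)]
    exact hasDerivAt_reflection_of_eq_zero ht hd h0

end Reflection

section CausalEquation

variable {E : Type*} [NormedAddCommGroup E] [NormedSpace ℝ E]

/-- The antiderivative `t ↦ z₀ + ∫ s in 0..t, w s` of a continuous path. -/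
noncomputable def primitive (z₀ : E) (w : C(ℝ, E)) : C(ℝ, E) where
  toFun t := z₀ + ∫ s in (0 : ℝ)..t, w s
  continuous_toFun := continuous_const.add
    (intervalIntegral.continuous_primitive (fun _ _ => w.continuous.intervalIntegrable _ _) 0)

theorem primitive_zero (z₀ : E) (w : C(ℝ, E)) : primitive z₀ w 0 = z₀ := by simp [primitive]

theorem hasDerivAt_primitive [CompleteSpace E] (z₀ : E) (w : C(ℝ, E)) (t : ℝ) :
    HasDerivAt (primitive z₀ w) (w t) t :=
  (w.continuous.integral_hasStrictDerivAt 0 t).hasDerivAt.const_add z₀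

theorem contDiff_primitive [CompleteSpace E] (z₀ : E) (w : C(ℝ, E)) :
    ContDiff ℝ 1 (primitive z₀ w) := by
  rw [contDiff_one_iff_deriv, funext fun t => (hasDerivAt_primitive z₀ w t).deriv]
  exact ⟨fun t => (hasDerivAt_primitive z₀ w t).differentiableAt, w.continuous⟩

theorem dist_primitive_le_of_dist_le_exp {z₀ : E} {v w : C(ℝ, E)} {c L t : ℝ} (hL : 0 < L)
    (hc : 0 ≤ c) (ht : 0 ≤ t) (h : ∀ s ∈ Icc 0 t, dist (v s) (w s) ≤ c * Real.exp (L * s)) :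
    dist (primitive z₀ v t) (primitive z₀ w t) ≤ c / L * Real.exp (L * t) := by
  have hint : ∀ u : C(ℝ, E), IntervalIntegrable u volume 0 t := fun u =>
    u.continuous.intervalIntegrable _ _
  have hexp : ∫ s in (0 : ℝ)..t, c * Real.exp (L * s) = c / L * (Real.exp (L * t) - 1) := by
    rw [intervalIntegral.integral_const_mul, intervalIntegral.integral_comp_mul_left _ hL.ne',
      integral_exp, mul_zero, Real.exp_zero, smul_eq_mul]
    ring
  calc dist (primitive z₀ v t) (primitive z₀ w t) = ‖∫ s in (0 : ℝ)..t, v s - w s‖ := by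
        rw [intervalIntegral.integral_sub (hint v) (hint w), ← dist_eq_norm]
        exact dist_add_left _ _ _
    _ ≤ ∫ s in (0 : ℝ)..t, c * Real.exp (L * s) :=
        intervalIntegral.norm_integral_le_of_norm_le ht
          (Eventually.of_forall fun s hs => dist_eq_norm (v s) (w s) ▸ h s (Ioc_subset_Icc_self hs))
          (Continuous.intervalIntegrable (by fun_prop) _ _)
    _ ≤ c / L * Real.exp (L * t) := by
        rw [hexp]
        gcongr
        exact sub_le_self _ zero_le_one

variable {T L : ℝ} {K : ℝ≥0} {Φ : C(ℝ, E) → C(ℝ, E)}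

/-- The path on `ℝ` encoded by `v` in exponentially weighted coordinates, `t ↦ exp (L t) v t`. -/
noncomputable def weightedExtend (hT : 0 ≤ T) (L : ℝ) (v : C(Icc 0 T, E)) : C(ℝ, E) where
  toFun t := Real.exp (L * t) • IccExtend hT v t
  continuous_toFun := by
    have := v.continuous.Icc_extend' (h := hT)
    fun_prop

theorem dist_weightedExtend_le (hT : 0 ≤ T) (v w : C(Icc 0 T, E)) (t : ℝ) :
    dist (weightedExtend hT L v t) (weightedExtend hT L w t) ≤ dist v w * Real.exp (L * t) := by
  refine (dist_smul_le _ _ _).trans ?_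
  rw [Real.norm_eq_abs, Real.abs_exp, mul_comm]
  gcongr
  exact ContinuousMap.dist_apply_le_dist _

/-- The Picard map of `u' = Φ u`, `u 0 = z₀`, in exponentially weighted coordinates. -/
noncomputable def picardMap (hT : 0 ≤ T) (L : ℝ) (Φ : C(ℝ, E) → C(ℝ, E)) (z₀ : E)
    (v : C(Icc 0 T, E)) : C(Icc 0 T, E) where
  toFun t := Real.exp (-(L * t)) • primitive z₀ (Φ (weightedExtend hT L v)) t
  continuous_toFun := by fun_prop

theorem weightedExtend_picardMap (hT : 0 ≤ T) (z₀ : E) (v : C(Icc 0 T, E)) {t : ℝ}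
    (ht : t ∈ Icc 0 T) : weightedExtend hT L (picardMap hT L Φ z₀ v) t =
      primitive z₀ (Φ (weightedExtend hT L v)) t := by
  calc Real.exp (L * t) • IccExtend hT (picardMap hT L Φ z₀ v) t
      = Real.exp (L * t) • Real.exp (-(L * t)) • primitive z₀ (Φ (weightedExtend hT L v)) t := by
        rw [IccExtend_of_mem hT _ ht]
        rfl
    _ = primitive z₀ (Φ (weightedExtend hT L v)) t := by
        rw [smul_smul, ← Real.exp_add, add_neg_cancel, Real.exp_zero, one_smul]

/-- With weight `exp (-(K + 1) t)` a single Picard step is already a contraction. -/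
theorem contractingWith_picardMap (hΦ : IsCausalLipschitz K Φ) (hT : 0 ≤ T) (z₀ : E) :
    ContractingWith (K / (K + 1)) (picardMap hT (K + 1) Φ z₀) := by
  refine ⟨(div_lt_one (by positivity)).2 (lt_add_one K), LipschitzWith.of_dist_le_mul fun v w => ?_⟩
  refine (ContinuousMap.dist_le (by positivity)).2 fun t => ?_
  set L : ℝ := K + 1 with hL
  have hcausal : ∀ s ∈ Icc 0 (t : ℝ), dist (Φ (weightedExtend hT L v) s)
      (Φ (weightedExtend hT L w) s) ≤ K * dist v w * Real.exp (L * s) := fun s hs => by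
    rw [mul_assoc]
    refine hΦ hs.1 fun r hr => (dist_weightedExtend_le hT v w r).trans ?_
    gcongr
    exact hr.2
  calc dist (picardMap hT L Φ z₀ v t) (picardMap hT L Φ z₀ w t)
      ≤ Real.exp (-(L * t)) * (K * dist v w / L * Real.exp (L * t)) := by
        refine (dist_smul_le _ _ _).trans ?_
        rw [Real.norm_eq_abs, Real.abs_exp]
        gcongr
        exact dist_primitive_le_of_dist_le_exp (by positivity) (by positivity) t.2.1 hcausal
    _ = K * dist v w / L * (Real.exp (-(L * t)) * Real.exp (L * t)) := by ring
    _ = (K / (K + 1) : ℝ≥0) * dist v w := by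
        rw [← Real.exp_add, neg_add_cancel, Real.exp_zero, hL]
        push_cast
        ring

theorem IsCausalLipschitz.exists_hasDerivAt [CompleteSpace E] (hΦ : IsCausalLipschitz K Φ)
    (T : ℝ) (z₀ : E) : ∃ u : C(ℝ, E), u 0 = z₀ ∧ ContDiff ℝ 1 u ∧
      ∀ t ∈ Icc 0 T, HasDerivAt u (Φ u t) t := by
  rcases lt_or_ge T 0 with hT | hT
  · exact ⟨.const ℝ z₀, rfl, contDiff_const, fun t ht => absurd (ht.1.trans ht.2) (not_le.2 hT)⟩
  obtain ⟨v, hv, -⟩ := (contractingWith_picardMap hΦ hT z₀).exists_fixedPoint 0 (edist_ne_top _ _)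
  set w := weightedExtend hT (K + 1) v
  have heq : ∀ t ∈ Icc 0 T, w t = primitive z₀ (Φ w) t := fun t ht => by
    rw [← weightedExtend_picardMap hT z₀ v ht, hv]
  refine ⟨primitive z₀ (Φ w), primitive_zero _ _, contDiff_primitive _ _, fun t ht => ?_⟩
  have hΦeq : dist (Φ w t) (Φ (primitive z₀ (Φ w)) t) ≤ K * 0 := hΦ ht.1 fun s hs => by
    rw [heq s ⟨hs.1, hs.2.trans ht.2⟩, dist_self]
  rw [mul_zero, dist_le_zero] at hΦeq
  exact hΦeq ▸ hasDerivAt_primitive z₀ (Φ w) t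

end CausalEquation

section Cutoff

variable {X E : Type*}

theorem locallyLipschitz_smul [PseudoEMetricSpace X] [NormedAddCommGroup E] [NormedSpace ℝ E]
    {φ : X → ℝ} {ψ : X → E} (hφ : LocallyLipschitz φ) (hψ : LocallyLipschitz ψ) :
    LocallyLipschitz fun x => φ x • ψ x :=
  (show ContDiff ℝ 1 fun p : ℝ × E => p.1 • p.2 by fun_prop).locallyLipschitz.comp (hφ.prodMk hψ)

theorem locallyLipschitz_sum {ι : Type*} [PseudoEMetricSpace X] [SeminormedAddCommGroup E]
    (s : Finset ι) {ψ : ι → X → E} (hψ : ∀ i ∈ s, LocallyLipschitz (ψ i)) :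
    LocallyLipschitz fun x => ∑ i ∈ s, ψ i x := by
  classical
  induction s using Finset.induction_on with
  | empty => simpa using LocallyLipschitz.const (0 : E)
  | insert i s hi ih =>
    simp only [Finset.sum_insert hi]
    exact (hψ i (Finset.mem_insert_self i s)).add
      (ih fun j hj => hψ j (Finset.mem_insert_of_mem hj))

theorem exists_lipschitzWith_of_hasCompactSupport [PseudoMetricSpace X] [ProperSpace X]
    [SeminormedAddCommGroup E] {ψ : X → E} (hψ : LocallyLipschitz ψ) (hc : HasCompactSupport ψ) :
    ∃ K, LipschitzWith K ψ := by
  have hthick : IsCompact (Metric.cthickening 1 (tsupport ψ)) := hc.isCompact.cthickening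
  obtain ⟨K, hK⟩ := hψ.locallyLipschitzOn.exists_lipschitzOnWith_of_compact hthick
  obtain ⟨M, hM⟩ := hc.exists_bound_of_continuous hψ.continuous
  have hzero : ∀ {x}, x ∉ tsupport ψ → ψ x = 0 := image_eq_zero_of_notMem_tsupport
  have hsupp : ∀ x ∈ tsupport ψ, ∀ y, dist (ψ x) (ψ y) ≤ max K M.toNNReal * dist x y := by
    intro x hx y
    by_cases hy : y ∈ Metric.cthickening 1 (tsupport ψ)
    · refine (hK.dist_le_mul x (Metric.self_subset_cthickening _ hx) y hy).trans ?_
      gcongr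
      exact le_max_left _ _
    · have hxy : 1 ≤ dist x y := by
        by_contra! hlt
        exact hy (Metric.mem_cthickening_of_dist_le y x 1 _ hx (dist_comm x y ▸ hlt.le))
      rw [hzero fun h => hy (Metric.self_subset_cthickening _ h), dist_zero_right]
      calc ‖ψ x‖ ≤ (max K M.toNNReal : ℝ≥0) :=
            (hM x).trans ((Real.le_coe_toNNReal M).trans (mod_cast le_max_right _ _))
        _ ≤ (max K M.toNNReal : ℝ≥0) * dist x y := le_mul_of_one_le_right (by positivity) hxy
  refine ⟨max K M.toNNReal, LipschitzWith.of_dist_le_mul fun x y => ?_⟩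
  by_cases hx : x ∈ tsupport ψ
  · exact hsupp x hx y
  by_cases hy : y ∈ tsupport ψ
  · rw [dist_comm, dist_comm x]
    exact hsupp y hy x
  · rw [hzero hx, hzero hy, dist_self]
    positivity

end Cutoff

section Projection

variable {n m : ℕ}

theorem isClosed_domain (n m : ℕ) : IsClosed (domain n m) := by
  simp only [domain, ofPred_forall]
  exact isClosed_iInter fun i => isClosed_le continuous_const (by fun_prop)

theorem dist_le_of_coord {z w : State n m} {c : ℝ} (h1 : dist z.1 w.1 ≤ c)
    (h2 : ∀ i, dist (z.2 i) (w.2 i) ≤ c) : dist z w ≤ (1 + m : ℝ≥0) * c := by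
  have hc : 0 ≤ c := dist_nonneg.trans h1
  push_cast
  refine max_le (h1.trans (by nlinarith [m.cast_nonneg (α := ℝ)])) ?_
  rw [EuclideanSpace.dist_eq]
  refine Real.sqrt_le_iff.2 ⟨by positivity, ?_⟩
  calc ∑ i, dist (z.2 i) (w.2 i) ^ 2 ≤ ∑ _ : Fin m, c ^ 2 := by gcongr with i; exact h2 i
    _ = m * c ^ 2 := by simp
    _ ≤ ((1 + m) * c) ^ 2 := by
      nlinarith [mul_nonneg (m.cast_nonneg (α := ℝ)) (sq_nonneg c), sq_nonneg (m * c), sq_nonneg c]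

theorem hasDerivAt_of_coord {γ : ℝ → State n m} {γ' : State n m} {t : ℝ}
    (h1 : HasDerivAt (fun t => (γ t).1) γ'.1 t)
    (h2 : ∀ i, HasDerivAt (fun t => (γ t).2 i) (γ'.2 i) t) : HasDerivAt γ γ' t := by
  have h3 : HasDerivAt (fun t => (γ t).2) γ'.2 t :=
    (PiLp.continuousLinearEquiv 2 ℝ fun _ : Fin m => ℝ).symm.hasFDerivAt.comp_hasDerivAt t
      (hasDerivAt_pi.2 h2)
  exact h1.prodMk h3

/-- The path of the `i`-th multiplier of a path in `ℝⁿ × ℝᵐ`. -/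
def multiplierPath (u : C(ℝ, State n m)) (i : Fin m) : C(ℝ, ℝ) where
  toFun t := (u t).2 i
  continuous_toFun := by fun_prop

/-- The path `(x, λ)` obtained from `(x, y)` by reflecting each coordinate of `y` at `0`. -/
noncomputable def reflectPath (u : C(ℝ, State n m)) : C(ℝ, State n m) where
  toFun t := ((u t).1, WithLp.toLp 2 fun i => reflection (multiplierPath u i) t)
  continuous_toFun := by fun_prop

theorem dist_multiplier_le (z w : State n m) (i : Fin m) : dist (z.2 i) (w.2 i) ≤ dist z w := by
  rw [dist_eq_norm, dist_eq_norm]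
  exact (PiLp.norm_apply_le (z - w).2 i).trans (norm_snd_le _)

theorem reflectPath_mem_domain (u : C(ℝ, State n m)) {t : ℝ} (ht : 0 ≤ t) :
    reflectPath u t ∈ domain n m :=
  fun _ => reflection_nonneg ht

theorem reflectPath_zero {u : C(ℝ, State n m)} (h0 : u 0 ∈ domain n m) : reflectPath u 0 = u 0 :=
  Prod.ext rfl (PiLp.ext fun i => reflection_zero (y := multiplierPath u i) (h0 i))

theorem isCausalLipschitz_reflectPath :
    IsCausalLipschitz ((1 + m : ℝ≥0) * 2) (reflectPath (n := n) (m := m)) := by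
  intro u v t c ht h
  have hu : dist (u t) (v t) ≤ c := h t ⟨ht, le_rfl⟩
  have hc : 0 ≤ c := dist_nonneg.trans hu
  rw [NNReal.coe_mul, mul_assoc]
  refine dist_le_of_coord ((le_max_left _ _).trans (hu.trans ?_)) fun i => ?_
  · exact le_mul_of_one_le_left hc (by norm_num)
  · exact isCausalLipschitz_reflection ht fun s hs => (dist_multiplier_le _ _ i).trans (h s hs)

theorem lipschitzOnWith_reflectPath {u : C(ℝ, State n m)} {K : ℝ≥0} {b : ℝ}
    (h : LipschitzOnWith K u (Icc 0 b)) :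
    LipschitzOnWith ((1 + m) * (2 * K)) (reflectPath u) (Icc 0 b) := by
  refine LipschitzOnWith.of_dist_le_mul fun s hs t ht => ?_
  rw [NNReal.coe_mul, mul_assoc]
  refine dist_le_of_coord ?_ fun i => ?_
  · refine ((le_max_left _ _).trans (h.dist_le_mul s hs t ht)).trans ?_
    gcongr
    exact le_mul_of_one_le_left' one_le_two
  · refine (lipschitzOnWith_reflection (LipschitzOnWith.of_dist_le_mul fun r hr q hq => ?_)
      ).dist_le_mul s hs t ht
    exact (dist_multiplier_le _ _ i).trans (h.dist_le_mul r hr q hq)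

theorem absolutelyContinuousOnInterval_reflectPath {u : C(ℝ, State n m)} (hu : ContDiff ℝ 1 u)
    {b : ℝ} (hb : 0 ≤ b) : AbsolutelyContinuousOnInterval (reflectPath u) 0 b := by
  obtain ⟨K, hK⟩ := (hu.locallyLipschitz.locallyLipschitzOn (s := Icc 0 b)
    ).exists_lipschitzOnWith_of_compact isCompact_Icc
  have hLip := lipschitzOnWith_reflectPath hK
  rw [← uIcc_of_le hb] at hLip
  exact hLip.absolutelyContinuousOnInterval

/-- The field `H` with its multiplier components constrained, at the boundary of `domain n m`, to
directions that do not leave it. -/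
noncomputable def projectedField (H : State n m → State n m) (z : State n m) : State n m :=
  ((H z).1, WithLp.toLp 2 fun i => posPart ((H z).2 i) (z.2 i))

theorem hasDerivAt_reflectPath {H : State n m → State n m} {u : C(ℝ, State n m)} {t : ℝ}
    (ht : 0 < t) (hu : HasDerivAt u (H (reflectPath u t)) t)
    (hd : ∀ i, DifferentiableAt ℝ (fun s => (reflectPath u s).2 i) t) :
    HasDerivAt (reflectPath u) (projectedField H (reflectPath u t)) t := by
  refine hasDerivAt_of_coord ?_ fun i => hasDerivAt_reflection ht ?_ (hd i)
  · exact (ContinuousLinearMap.fst ℝ _ _).hasFDerivAt.comp_hasDerivAt t hu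
  · exact ((EuclideanSpace.proj i : EuclideanSpace ℝ (Fin m) →L[ℝ] ℝ).comp
      (ContinuousLinearMap.snd ℝ _ _)).hasFDerivAt.comp_hasDerivAt t hu

theorem isCaratheodorySolution_reflectPath {H : State n m → State n m} {u : C(ℝ, State n m)}
    {b : ℝ} (hu : ContDiff ℝ 1 u) (hder : ∀ t ∈ Icc 0 b, HasDerivAt u (H (reflectPath u t)) t) :
    IsCaratheodorySolution (domain n m) (projectedField H) b (reflectPath u) := by
  refine ⟨fun c hc _ => absolutelyContinuousOnInterval_reflectPath hu hc, ?_⟩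
  have hdiff : ∀ᵐ t : ℝ, t ∈ Ioo 0 b →
      ∀ i, DifferentiableAt ℝ (fun s => (reflectPath u s).2 i) t := by
    rcases lt_or_ge b 0 with hb | hb
    · simp [Ioo_eq_empty hb.le.not_gt]
    have hac := fun i => absolutelyContinuousOnInterval_lipschitzWith_comp
      (LipschitzWith.mk_one fun z w => dist_multiplier_le z w i)
      (absolutelyContinuousOnInterval_reflectPath hu hb)
    filter_upwards [ae_all_iff.2 fun i => (hac i).ae_differentiableAt] with t hd ht i
    exact hd i (uIcc_of_le hb ▸ Ioo_subset_Icc_self ht)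
  filter_upwards [hdiff, Measure.ae_ne volume 0] with t hd hne h0t htb
  have ht : t ∈ Ioo 0 b := ⟨h0t.lt_of_ne' hne, EReal.coe_lt_coe_iff.1 htb⟩
  exact ⟨reflectPath_mem_domain u h0t,
    hasDerivAt_reflectPath ht.1 (hder t (Ioo_subset_Icc_self ht)) (hd ht)⟩

theorem exists_isCaratheodorySolution_projectedField_of_lipschitzWith
    {H : State n m → State n m} {K : ℝ≥0} (hH : LipschitzWith K H) (b : ℝ) {z₀ : State n m}
    (hz₀ : z₀ ∈ domain n m) :
    ∃ γ, IsCaratheodorySolution (domain n m) (projectedField H) b γ ∧ γ 0 = z₀ := by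
  obtain ⟨u, rfl, hu, hder⟩ :=
    (isCausalLipschitz_comp hH isCausalLipschitz_reflectPath).exists_hasDerivAt b z₀
  exact ⟨reflectPath u, isCaratheodorySolution_reflectPath hu hder, reflectPath_zero hz₀⟩

theorem posPart_mul_left {c : ℝ} (hc : 0 ≤ c) (a b : ℝ) : posPart (c * a) b = c * posPart a b := by
  unfold posPart
  split_ifs
  · rfl
  · rw [← mul_zero c, ← mul_max_of_nonneg _ _ hc, mul_zero]

theorem projectedField_smul {χ : State n m → ℝ} (hχ : ∀ z, 0 ≤ χ z) (H : State n m → State n m) :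
    projectedField (fun z => χ z • H z) = fun z => χ z • projectedField H z :=
  funext fun z => Prod.ext rfl (PiLp.ext fun i => posPart_mul_left (hχ z) ((H z).2 i) (z.2 i))

/-- By dissipativity, solutions of the field multiplied by a cutoff satisfy
`‖A (γ t - z₀)‖ ≤ ‖A (projectedField H z₀)‖ * t` whatever the cutoff; taken wide enough, it is never
felt on `[0, b)`. -/
theorem exists_isCaratheodorySolution_projectedField {H' : Type*} [NormedAddCommGroup H']
    [InnerProductSpace ℝ H'] {A : State n m →L[ℝ] H'} {K : ℝ≥0} {H : State n m → State n m}
    (hA : AntilipschitzWith K A) (hH : LocallyLipschitz H)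
    (hdiss : IsDissipativeOn A (domain n m) (projectedField H)) (b : ℝ) {z₀ : State n m}
    (hz₀ : z₀ ∈ domain n m) :
    ∃ γ, IsCaratheodorySolution (domain n m) (projectedField H) b γ ∧ γ 0 = z₀ := by
  set M := ‖A (projectedField H z₀)‖
  have hR : 0 < K * (M * |b|) + 1 := by positivity
  let χ : ContDiffBump z₀ := ⟨K * (M * |b|) + 1, K * (M * |b|) + 2, hR, by linarith⟩
  have hχ : LocallyLipschitz χ := (χ.contDiff (n := 1)).locallyLipschitz
  obtain ⟨L, hL⟩ := exists_lipschitzWith_of_hasCompactSupport (locallyLipschitz_smul hχ hH)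
    χ.hasCompactSupport.smul_right
  obtain ⟨γ, hγ, rfl⟩ :=
    exists_isCaratheodorySolution_projectedField_of_lipschitzWith hL b hz₀
  rw [projectedField_smul χ.nonneg'] at hγ
  have hone : ∀ t : ℝ, 0 ≤ t → (t : EReal) < b → χ (γ t) = 1 := fun t ht htb => by
    refine χ.one_of_mem_closedBall (mem_closedBall_iff_norm.2 ?_)
    have htb' : t ≤ |b| := (EReal.coe_lt_coe_iff.1 htb).le.trans (le_abs_self b)
    calc ‖γ t - γ 0‖ ≤ K * ‖A (γ t - γ 0)‖ := by
          simpa [dist_eq_norm] using hA.le_mul_dist (γ t) (γ 0)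
      _ ≤ K * (M * t) := by
          gcongr
          exact hdiss.norm_map_sub_initial_le_of_smul (fun z => ⟨χ.nonneg, χ.le_one⟩) hγ hz₀ ht htb
      _ ≤ K * (M * |b|) + 1 := by
          have : K * (M * t) ≤ K * (M * |b|) := by gcongr
          linarith
  refine ⟨γ, ⟨hγ.1, ?_⟩, rfl⟩
  filter_upwards [hγ.2] with t hγt ht htb
  obtain ⟨hD, hderiv⟩ := hγt ht htb
  rw [hone t ht htb, one_smul] at hderiv
  exact ⟨hD, hderiv⟩

theorem exists_isCaratheodorySolution_projectedField_top {H' : Type*} [NormedAddCommGroup H']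
    [InnerProductSpace ℝ H'] {A : State n m →L[ℝ] H'} {K : ℝ≥0} {H : State n m → State n m}
    (hA : AntilipschitzWith K A) (hH : LocallyLipschitz H)
    (hdiss : IsDissipativeOn A (domain n m) (projectedField H)) {z₀ : State n m}
    (hz₀ : z₀ ∈ domain n m) :
    ∃ γ, IsCaratheodorySolution (domain n m) (projectedField H) ⊤ γ ∧ γ 0 = z₀ :=
  exists_isCaratheodorySolution_top
    (fun _ _ _ hγ hη h0 _ ht => hdiss.eq_of_isCaratheodorySolution hA.injective hγ hη h0 ht.1
      (EReal.coe_lt_coe_iff.2 ht.2))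
    fun b => exists_isCaratheodorySolution_projectedField hA hH hdiss b hz₀

end Projection

section Lagrangian

variable {n m : ℕ}

theorem le_add_inner_of_concaveOn {E : Type*} [NormedAddCommGroup E] [InnerProductSpace ℝ E]
    [CompleteSpace E] {h : E → ℝ} {h' x : E} (hc : ConcaveOn ℝ univ h) (hx : HasGradientAt h h' x)
    (y : E) : h y ≤ h x + ⟪h', y - x⟫ := by
  have hline : HasDerivAt (h ∘ AffineMap.lineMap x y) ⟪h', y - x⟫ (0 : ℝ) := by
    have hx0 := (AffineMap.lineMap_apply_zero (k := ℝ) x y).symm ▸ hx.hasFDerivAt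
    exact hx0.comp_hasDerivAt 0 AffineMap.hasDerivAt_lineMap
  have hslope := (hc.comp_affineMap (AffineMap.lineMap x y)).slope_le_of_hasDerivAt
    (mem_univ 0) (mem_univ 1) zero_lt_one hline
  simp only [slope_def_field, Function.comp_apply, AffineMap.lineMap_apply_zero,
    AffineMap.lineMap_apply_one, sub_zero, div_one] at hslope
  linarith

theorem convexOn_sum {ι E : Type*} [AddCommGroup E] [Module ℝ E] {S : Set E} {h : ι → E → ℝ}
    (s : Finset ι) (hS : Convex ℝ S) (hh : ∀ i ∈ s, ConvexOn ℝ S (h i)) :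
    ConvexOn ℝ S fun x => ∑ i ∈ s, h i x := by
  classical
  induction s using Finset.induction_on with
  | empty => simpa using convexOn_const 0 hS
  | insert i s hi ih =>
    simp only [Finset.sum_insert hi]
    exact (hh i (Finset.mem_insert_self i s)).add
      (ih fun j hj => hh j (Finset.mem_insert_of_mem hj))

theorem le_posPart (a b : ℝ) : a ≤ posPart a b := by
  unfold posPart
  split_ifs
  · exact le_rfl
  · exact le_max_right 0 a

theorem posPart_mul_self (a : ℝ) {b : ℝ} (hb : 0 ≤ b) : posPart a b * b = a * b := by
  unfold posPart
  split_ifs with h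
  · rfl
  · simp [le_antisymm (not_lt.1 h) hb]

theorem sub_mul_posPart_le (a : ℝ) {b c : ℝ} (hb : 0 ≤ b) (hc : 0 ≤ c) :
    (b - c) * posPart a b ≤ (b - c) * a := by
  linarith [posPart_mul_self a hb, mul_le_mul_of_nonneg_left (le_posPart a b) hc]

/-- The passage from `ℝⁿ × ℝᵐ`, whose norm is the maximum of the two Euclidean norms, to the
Euclidean product. -/
noncomputable def toL2 (n m : ℕ) :
    State n m →L[ℝ] WithLp 2 (EuclideanSpace ℝ (Fin n) × EuclideanSpace ℝ (Fin m)) :=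
  ↑(WithLp.prodContinuousLinearEquiv 2 ℝ (EuclideanSpace ℝ (Fin n))
    (EuclideanSpace ℝ (Fin m))).symm

theorem antilipschitzWith_toL2 (n m : ℕ) : AntilipschitzWith 1 (toL2 n m) :=
  WithLp.prod_antilipschitzWith_toLp 2 _ _

theorem inner_toL2 (z w : State n m) :
    ⟪toL2 n m z, toL2 n m w⟫ = ⟪z.1, w.1⟫ + ∑ i, z.2 i * w.2 i := by
  rw [WithLp.prod_inner_apply, PiLp.inner_apply]
  exact congrArg₂ _ rfl (Finset.sum_congr rfl fun i _ => mul_comm _ _)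

theorem V_eq_norm_toL2_sq (zs z : State n m) : V zs z = 1 / 2 * ‖toL2 n m (z - zs)‖ ^ 2 := by
  rw [WithLp.prod_norm_sq_eq_of_L2]
  rfl

variable {f : EuclideanSpace ℝ (Fin n) → ℝ}
  {g : EuclideanSpace ℝ (Fin n) → EuclideanSpace ℝ (Fin m)}

theorem concaveOn_lagrangian (hf : ConcaveOn ℝ univ f) (hg : ∀ i, ConvexOn ℝ univ fun x => g x i)
    {l : EuclideanSpace ℝ (Fin m)} (hl : ∀ i, 0 ≤ l i) :
    ConcaveOn ℝ univ fun x => lagrangian f g (x, l) :=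
  hf.sub (convexOn_sum _ convex_univ fun i _ => (hg i).smul (hl i))

theorem hasGradientAt_lagrangian {z : State n m} (hf : DifferentiableAt ℝ f z.1)
    (hg : DifferentiableAt ℝ g z.1) :
    HasGradientAt (fun x => lagrangian f g (x, z.2)) (field f g z).1 z.1 := by
  have hgi : ∀ i, DifferentiableAt ℝ (fun x => g x i) z.1 := by fun_prop
  have hsum := HasFDerivAt.fun_sum fun i (_ : i ∈ Finset.univ) =>
    (hgi i).hasGradientAt.hasFDerivAt.const_mul (z.2 i)
  rw [hasGradientAt_iff_hasFDerivAt]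
  simp only [field, map_sub, map_sum, map_smul]
  exact hf.hasGradientAt.hasFDerivAt.sub hsum

/-- The primal part is bounded by concavity of the Lagrangian in `x`. In the multiplier part,
replacing `[g]⁺` by `g` only increases the inner product, by complementarity, and the Lagrangian is
affine in `λ`. -/
theorem inner_field_le_lagrangian_sub (hf : Differentiable ℝ f) (hg : Differentiable ℝ g)
    (hfconc : ConcaveOn ℝ univ f) (hgconv : ∀ i, ConvexOn ℝ univ fun x => g x i)
    {z w : State n m} (hz : z ∈ domain n m) (hw : w ∈ domain n m) :
    ⟪toL2 n m (z - w), toL2 n m (field f g z)⟫ ≤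
      lagrangian f g (z.1, w.2) - lagrangian f g (w.1, z.2) := by
  have hprimal : ⟪(z - w).1, (field f g z).1⟫ ≤
      lagrangian f g z - lagrangian f g (w.1, z.2) := by
    have hconc := le_add_inner_of_concaveOn (concaveOn_lagrangian hfconc hgconv hz)
      (hasGradientAt_lagrangian (hf z.1) (hg z.1)) w.1
    rw [← neg_sub z.1 w.1, inner_neg_right, real_inner_comm] at hconc
    rw [Prod.fst_sub]
    linarith
  have hdual : ∑ i, (z - w).2 i * (field f g z).2 i ≤
      lagrangian f g (z.1, w.2) - lagrangian f g z := by
    calc ∑ i, (z - w).2 i * (field f g z).2 i ≤ ∑ i, (z.2 i - w.2 i) * g z.1 i :=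
          Finset.sum_le_sum fun i _ => sub_mul_posPart_le _ (hz i) (hw i)
      _ = lagrangian f g (z.1, w.2) - lagrangian f g z := by
          simp only [lagrangian, sub_mul, Finset.sum_sub_distrib]
          ring
  rw [inner_toL2]
  linarith

theorem isDissipativeOn_field (hf : Differentiable ℝ f) (hg : Differentiable ℝ g)
    (hfconc : ConcaveOn ℝ univ f) (hgconv : ∀ i, ConvexOn ℝ univ fun x => g x i) :
    IsDissipativeOn (toL2 n m) (domain n m) (field f g) := by
  intro z hz w hw
  have hzw := inner_field_le_lagrangian_sub hf hg hfconc hgconv hz hw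
  have hwz := inner_field_le_lagrangian_sub hf hg hfconc hgconv hw hz
  rw [← neg_sub z w, map_neg, inner_neg_left] at hwz
  rw [map_sub _ (field f g z), inner_sub_right]
  linarith

theorem V_le_V_of_isSaddle (hf : Differentiable ℝ f) (hg : Differentiable ℝ g)
    (hfconc : ConcaveOn ℝ univ f) (hgconv : ∀ i, ConvexOn ℝ univ fun x => g x i)
    {zs : State n m} (hzs : IsSaddle f g zs) {T : EReal} {γ : ℝ → State n m}
    (hγ : IsCaratheodorySolution (domain n m) (field f g) T γ) {t : ℝ} (ht : 0 ≤ t)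
    (htT : (t : EReal) < T) : V zs (γ t) ≤ V zs (γ 0) := by
  have hle := hγ.norm_map_sub_le (toL2 n m) le_rfl
    ((isCaratheodorySolution_const zs).mono le_top) ?_ ht htT
  · rw [V_eq_norm_toL2_sq, V_eq_norm_toL2_sq]
    gcongr
    simpa using hle
  · rintro z hz _ rfl
    have hinner := inner_field_le_lagrangian_sub hf hg hfconc hgconv hz hzs.1
    rw [sub_zero, zero_mul]
    linarith [hzs.2.1 z.1, hzs.2.2 z.2 hz]

/-- The right-hand side of the dynamics before its multiplier components are constrained:
`(∇f(x) - ∑ᵢ λᵢ ∇gᵢ(x), g(x))`. Unlike `field f g`, it is continuous. -/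
noncomputable def unprojectedField (f : EuclideanSpace ℝ (Fin n) → ℝ)
    (g : EuclideanSpace ℝ (Fin n) → EuclideanSpace ℝ (Fin m)) (z : State n m) : State n m :=
  (gradient f z.1 - ∑ i, z.2 i • gradient (fun y => g y i) z.1, g z.1)

theorem projectedField_unprojectedField (f : EuclideanSpace ℝ (Fin n) → ℝ)
    (g : EuclideanSpace ℝ (Fin n) → EuclideanSpace ℝ (Fin m)) :
    projectedField (unprojectedField f g) = field f g :=
  rfl

theorem locallyLipschitz_unprojectedField (hg : LocallyLipschitz g)
    (hfLip : LocallyLipschitz fun x => gradient f x)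
    (hgLip : ∀ i, LocallyLipschitz fun x => gradient (fun y => g y i) x) :
    LocallyLipschitz (unprojectedField f g) := by
  have hfst : LocallyLipschitz (Prod.fst : State n m → _) := LipschitzWith.prod_fst.locallyLipschitz
  have hmult : ∀ i, LocallyLipschitz fun z : State n m => z.2 i := fun i =>
    (LipschitzWith.mk_one fun z w => dist_multiplier_le z w i).locallyLipschitz
  have hsum : LocallyLipschitz fun z : State n m =>
      ∑ i, z.2 i • gradient (fun y => g y i) z.1 :=
    locallyLipschitz_sum _ fun i _ => locallyLipschitz_smul (hmult i) ((hgLip i).comp hfst)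
  exact ((hfLip.comp hfst).sub hsum).prodMk (hg.comp hfst)

end Lagrangian

end PrimalDual

theorem mainTheorem2_general {n m : ℕ}
    (f : EuclideanSpace ℝ (Fin n) → ℝ)
    (g : EuclideanSpace ℝ (Fin n) → EuclideanSpace ℝ (Fin m))
    (hf : Differentiable ℝ f) (hg : ContDiff ℝ 1 g)
    (hfconc : ConcaveOn ℝ Set.univ f)
    (hgconv : ∀ i, ConvexOn ℝ Set.univ (fun x => g x i))
    (hfLip : LocallyLipschitz (fun x => gradient f x))
    (hgLip : ∀ i, LocallyLipschitz (fun x => gradient (fun y => g y i) x)) :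
    (∀ z₀ ∈ PrimalDual.domain n m,
      ∃ γ : ℝ → PrimalDual.State n m,
        PrimalDual.IsCaratheodorySolution (PrimalDual.domain n m) (PrimalDual.field f g) ⊤ γ ∧
        γ 0 = z₀ ∧
        (∀ (T : EReal) (η : ℝ → PrimalDual.State n m),
          PrimalDual.IsCaratheodorySolution (PrimalDual.domain n m) (PrimalDual.field f g) T η →
          η 0 = z₀ → ∀ t : ℝ, 0 ≤ t → (t : EReal) < T → η t = γ t) ∧
        (∀ t : ℝ, 0 ≤ t → γ t ∈ PrimalDual.domain n m) ∧
        (∀ zs, PrimalDual.IsSaddle f g zs → ∀ t : ℝ, 0 ≤ t →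
          PrimalDual.V zs (γ t) ≤ PrimalDual.V zs z₀)) ∧
    (∀ (γ : ℝ → PrimalDual.State n m) (γs : ℕ → ℝ → PrimalDual.State n m),
      PrimalDual.IsCaratheodorySolution (PrimalDual.domain n m) (PrimalDual.field f g) ⊤ γ →
      (∀ k, PrimalDual.IsCaratheodorySolution (PrimalDual.domain n m)
        (PrimalDual.field f g) ⊤ (γs k)) →
      Filter.Tendsto (fun k => γs k 0) Filter.atTop (nhds (γ 0)) →
      TendstoUniformlyOn γs γ Filter.atTop (Set.Ici 0)) := by
  have hg' := hg.differentiable one_ne_zero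
  have hA := PrimalDual.antilipschitzWith_toL2 n m
  have hdiss := PrimalDual.isDissipativeOn_field hf hg' hfconc hgconv
  have hH := PrimalDual.locallyLipschitz_unprojectedField hg.locallyLipschitz hfLip hgLip
  refine ⟨fun z₀ hz₀ => ?_, fun γ γs hγ hγs h0 => hdiss.tendstoUniformlyOn hA hγs hγ h0⟩
  rw [← PrimalDual.projectedField_unprojectedField f g] at hdiss
  obtain ⟨γ, hγ, rfl⟩ :=
    PrimalDual.exists_isCaratheodorySolution_projectedField_top hA hH hdiss hz₀
  refine ⟨γ, hγ, rfl, fun T η hη h0 t ht htT => ?_, fun t ht => ?_, fun zs hzs t ht => ?_⟩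
  · exact hdiss.eq_of_isCaratheodorySolution hA.injective hη (hγ.mono le_top) h0 ht htT
  · exact hγ.mem_of_isClosed (PrimalDual.isClosed_domain n m) ht (EReal.coe_lt_top t)
  · exact PrimalDual.V_le_V_of_isSaddle hf hg' hfconc hgconv hzs hγ ht (EReal.coe_lt_top t)

theorem mainTheorem2 {n m : ℕ}
    (f : EuclideanSpace ℝ (Fin n) → ℝ)
    (g : EuclideanSpace ℝ (Fin n) → EuclideanSpace ℝ (Fin m))
    (hf : ContDiff ℝ 1 f) (hg : ContDiff ℝ 1 g)
    (hfconc : StrictConcaveOn ℝ Set.univ f)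
    (hgconv : ∀ i, ConvexOn ℝ Set.univ (fun x => g x i))
    (hfLip : LocallyLipschitz (fun x => gradient f x))
    (hgLip : ∀ i, LocallyLipschitz (fun x => gradient (fun y => g y i) x))
    (hSlater : ∃ x, ∀ i, g x i < 0) :
    -- existence on `[0, ∞)`, uniqueness, and invariance of the sublevel sets
    (∀ z₀ ∈ PrimalDual.domain n m,
      ∃ γ : ℝ → PrimalDual.State n m,
        PrimalDual.IsCaratheodorySolution (PrimalDual.domain n m) (PrimalDual.field f g) ⊤ γ ∧
        γ 0 = z₀ ∧
        (∀ (T : EReal) (η : ℝ → PrimalDual.State n m),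
          PrimalDual.IsCaratheodorySolution (PrimalDual.domain n m) (PrimalDual.field f g) T η →
          η 0 = z₀ → ∀ t : ℝ, 0 ≤ t → (t : EReal) < T → η t = γ t) ∧
        (∀ t : ℝ, 0 ≤ t → γ t ∈ PrimalDual.domain n m) ∧
        (∀ zs, PrimalDual.IsSaddle f g zs → ∀ t : ℝ, 0 ≤ t →
          PrimalDual.V zs (γ t) ≤ PrimalDual.V zs z₀)) ∧
    -- continuity with respect to the initial condition
    (∀ (z₀ : PrimalDual.State n m) (z : ℕ → PrimalDual.State n m),
      z₀ ∈ PrimalDual.domain n m → (∀ k, z k ∈ PrimalDual.domain n m) →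
      Filter.Tendsto z Filter.atTop (nhds z₀) →
      ∀ (γ : ℝ → PrimalDual.State n m) (γs : ℕ → ℝ → PrimalDual.State n m),
        PrimalDual.IsCaratheodorySolution (PrimalDual.domain n m) (PrimalDual.field f g) ⊤ γ →
        γ 0 = z₀ →
        (∀ k, PrimalDual.IsCaratheodorySolution (PrimalDual.domain n m)
          (PrimalDual.field f g) ⊤ (γs k)) →
        (∀ k, γs k 0 = z k) →
        ∀ K : Set ℝ, IsCompact K → K ⊆ Set.Ici 0 →
          TendstoUniformlyOn γs γ Filter.atTop K) := by
  have h := mainTheorem2_general f g (hf.differentiable one_ne_zero) hg hfconc.concaveOn hgconv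
    hfLip hgLip
  exact ⟨h.1, fun z₀ z _ _ hz γ γs hγ h0 hγs hs0 K _ hK =>
    (h.2 γ γs hγ hγs (by simpa only [h0, hs0] using hz)).mono hK⟩
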